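/- There is (in ZFC) a countable Hausdorff zero-dimensional (hence regular) topological space $X$ that is mH-separable (also called wH-separable) but not H-separable. Here $X$ is zero-dimensional if its topology has a base of clopen sets. $X$ is H-separable if for every sequence $(D_n)_{n\in\omega}$ of dense subsets of $X$ there are finite sets $F_n\subset D_n$ $(n\in\omega)$ such that $\bigcup_{n\in A}F_n$ is dense in $X$ for every infinite $A\subset\omega$. $X$ is mH-separable if such finite sets exist for every descending sequence $D_0\supseteq D_1\supseteq\cdots$ of dense subsets of $X$. -/

import Mathlib

open Set TopologicalSpace

/-- A selection of finite sets `F n ⊆ D n` such that the union over every infinite set of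
indices is dense. -/
def HasHSelection {X : Type*} [TopologicalSpace X] (D : ℕ → Set X) : Prop :=
  ∃ F : ℕ → Finset X, (∀ n, (F n : Set X) ⊆ D n) ∧
    ∀ A : Set ℕ, A.Infinite → Dense (⋃ n ∈ A, (F n : Set X))

/-- `X` is H-separable: every sequence of dense subsets has such a selection. -/
def HSeparable (X : Type*) [TopologicalSpace X] : Prop :=
  ∀ D : ℕ → Set X, (∀ n, Dense (D n)) → HasHSelection D

/-- `X` is mH-separable (also called wH-separable): every descending sequence of dense
subsets has such a selection. -/
def MHSeparable (X : Type*) [TopologicalSpace X] : Prop :=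
  ∀ D : ℕ → Set X, Antitone D → (∀ n, Dense (D n)) → HasHSelection D

/-- `X` is zero-dimensional: the clopen sets form a base of the topology. -/
def ZeroDimensional (X : Type*) [TopologicalSpace X] : Prop :=
  IsTopologicalBasis {s : Set X | IsClopen s}

open Filter Topology

/-! ### A well-ordered unbounded scale of minimal length -/

/-! Fix a well-ordered unbounded scale `h` whose length is the bounding number. Points are finite
sets of naturals, and for each `n`, `l` those with maximum in column `(n, l)` form a dense set. A
finite selection from these sets bounds the maxima by some `g n l`. Some `h a` has `g n (h a n) < h
a (n + 1)` for infinitely many `n` (`exists_frequently_lt`), so `h a` kills the maximum of every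
point selected from the columns `(n, h a n)` for these `n`, and all these points miss the open set
of points alive for `h a`.

For a descending sequence, every open set contains a point `t` approximable by points whose columns
stay bounded or escape to infinity (`exists_sift`). By `exists_bound_on_infinite`, some `h a`
bounds, along an infinite set, approximations respecting any finitely many indices below `a`. For
indices `c ≥ a` nothing needs to be arranged: `h c` is so large that the maximum is not killed and
rescues all new elements in time. Countability of the space then combines the selections. -/

/-- A family of functions is bounded if a single function eventually dominates each member. -/
def EventuallyBounded (S : Set (ℕ → ℕ)) : Prop :=
  ∃ g : ℕ → ℕ, ∀ f ∈ S, f ≤ᶠ[atTop] g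

theorem eventuallyBounded_range_nat (f : ℕ → ℕ → ℕ) :
    ∃ g : ℕ → ℕ, ∀ k, ∀ n, k ≤ n → f k n ≤ g n :=
  ⟨fun n => ∑ k ∈ Finset.range (n + 1), f k n, fun k n hk =>
    Finset.single_le_sum (f := fun k => f k n) (fun _ _ => Nat.zero_le _)
      (Finset.mem_range.2 (by omega))⟩

theorem eventuallyBounded_of_countable {S : Set (ℕ → ℕ)} (hS : S.Countable) :
    EventuallyBounded S := by
  rcases S.eq_empty_or_nonempty with rfl | hne
  · exact ⟨0, by simp⟩
  obtain ⟨f, rfl⟩ := hS.exists_eq_range hne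
  obtain ⟨g, hg⟩ := eventuallyBounded_range_nat f
  refine ⟨g, ?_⟩
  rintro _ ⟨k, rfl⟩
  exact eventually_atTop.2 ⟨k, hg k⟩

theorem not_eventuallyBounded_univ : ¬ EventuallyBounded univ := by
  rintro ⟨g, hg⟩
  obtain ⟨n, hn⟩ := (hg (fun n => g n + 1) (mem_univ _)).exists
  exact Nat.not_succ_le_self _ hn

/-- A monotone, `≤ᶠ`-increasing unbounded family indexed by a well-order, such that families of
functions indexed by finite subsets of a proper initial segment are bounded. -/
structure IsScale {I : Type} [LinearOrder I] (h : I → ℕ → ℕ) : Prop where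
  mono : ∀ a, Monotone (h a)
  le : ∀ a b, a ≤ b → h a ≤ᶠ[atTop] h b
  unbounded : ¬ EventuallyBounded (range h)
  bounded : ∀ (a : I) (φ : Finset I → ℕ → ℕ),
    ∃ g : ℕ → ℕ, ∀ b : Finset I, (∀ c ∈ b, c < a) → φ b ≤ᶠ[atTop] g

-- The index set is the initial ordinal of the bounding number `κ`. As `κ` is uncountable, a proper
-- initial segment has fewer than `κ` finite subsets, so families indexed by them are bounded.
open Cardinal in
theorem exists_isScale :
    ∃ (I : Type) (_ : LinearOrder I) (_ : WellFoundedLT I) (h : I → ℕ → ℕ), IsScale h := by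
  classical
  let C : Set Cardinal.{0} := {c | ∃ S : Set (ℕ → ℕ), #S = c ∧ ¬ EventuallyBounded S}
  have hC : C.Nonempty := ⟨_, univ, rfl, not_eventuallyBounded_univ⟩
  obtain ⟨S, hS, hSu⟩ := csInf_mem hC
  have small : ∀ T : Set (ℕ → ℕ), #T < sInf C → EventuallyBounded T := fun T hT => by
    by_contra hb
    exact (csInf_le' (s := C) ⟨T, rfl, hb⟩).not_gt hT
  let κ := sInf C
  have hκ : ℵ₀ < κ := by
    by_contra hle
    refine hSu (eventuallyBounded_of_countable ?_)
    rw [← Cardinal.le_aleph0_iff_set_countable, hS]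
    exact not_lt.1 hle
  have hI : #κ.ord.ToType = #S := by rw [Cardinal.mk_ord_toType, hS]
  obtain ⟨e⟩ := Cardinal.eq.1 hI
  have hIio : ∀ a : κ.ord.ToType, #(Iio a) < κ := fun a => by
    simpa using Cardinal.mk_Iio_lt a (by simp)
  have step : ∀ (a : κ.ord.ToType) (r : ∀ b, b < a → ℕ → ℕ),
      ∃ f : ℕ → ℕ, Monotone f ∧ (e a : ℕ → ℕ) ≤ f ∧ ∀ b (hb : b < a), r b hb ≤ᶠ[atTop] f := by
    intro a r
    obtain ⟨g, hg⟩ := small (range fun b : Iio a => r b.1 b.2)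
      (mk_range_le.trans_lt (hIio a))
    refine ⟨fun n => ∑ i ∈ Finset.range (n + 1), ((e a : ℕ → ℕ) i + g i), ?_, ?_, ?_⟩
    · exact fun m n hmn => Finset.sum_le_sum_of_subset (Finset.range_mono (by omega))
    · intro n
      have := Finset.single_le_sum (f := fun i => (e a : ℕ → ℕ) i + g i)
        (fun _ _ => Nat.zero_le _) (Finset.self_mem_range_succ n)
      exact le_trans (Nat.le_add_right _ _) this
    · intro b hb
      filter_upwards [hg _ ⟨⟨b, hb⟩, rfl⟩] with n hn
      have := Finset.single_le_sum (f := fun i => (e a : ℕ → ℕ) i + g i)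
        (fun _ _ => Nat.zero_le _) (Finset.self_mem_range_succ n)
      exact hn.trans (le_trans (Nat.le_add_left _ _) this)
  choose F hFm hFe hFr using step
  let h : κ.ord.ToType → ℕ → ℕ := WellFoundedLT.fix F
  have hh : ∀ a, h a = F a fun b _ => h b := fun a => WellFoundedLT.fix_eq F a
  refine ⟨κ.ord.ToType, inferInstance, inferInstance, h, ?_, ?_, ?_, ?_⟩
  · intro a
    rw [hh]
    exact hFm _ _
  · intro a b hab
    rcases hab.eq_or_lt with rfl | hlt
    · exact EventuallyLE.refl _ _
    · rw [hh b]
      exact hFr b (fun c _ => h c) a hlt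
  · rintro ⟨g, hg⟩
    refine hSu ⟨g, fun f hf => ?_⟩
    have h1 := hg _ ⟨e.symm ⟨f, hf⟩, rfl⟩
    have h2 := hFe (e.symm ⟨f, hf⟩) fun b _ => h b
    rw [← hh, Equiv.apply_symm_apply] at h2
    filter_upwards [h1] with n hn
    exact (h2 n).trans hn
  · intro a φ
    have hcard : #(Finset (Iio a)) < κ := by
      rcases finite_or_infinite (Iio a) with hf | hf
      · exact (Cardinal.mk_lt_aleph0 (α := Finset (Iio a))).trans hκ
      · rw [Cardinal.mk_finset_of_infinite]
        exact hIio a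
    obtain ⟨g, hg⟩ := small
      (range fun b : Finset (Iio a) => φ (b.map (Function.Embedding.subtype _)))
      (mk_range_le.trans_lt hcard)
    refine ⟨g, fun b hb => ?_⟩
    have := hg _ ⟨b.subtype (· ∈ Iio a), rfl⟩
    have hmap : (b.subtype (· ∈ Iio a)).map (Function.Embedding.subtype _) = b :=
      Finset.subtype_map_of_mem hb
    simpa only [hmap] using this

/-! ### Combinatorics of scales. -/

namespace IsScale

variable {I : Type} [LinearOrder I] {h : I → ℕ → ℕ}

theorem exists_not_le (hs : IsScale h) (a : I) (g : ℕ → ℕ) :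
    ∃ b, a ≤ b ∧ ¬ h b ≤ᶠ[atTop] g := by
  by_contra! hcon
  refine hs.unbounded ⟨g, ?_⟩
  rintro _ ⟨b, rfl⟩
  exact (hs.le _ _ (le_max_right a b)).trans (hcon _ (le_max_left a b))

theorem bddAbove_range (hs : IsScale h) (a : ℕ → I) : BddAbove (range a) := by
  by_contra hcon
  obtain ⟨g, hg⟩ := eventuallyBounded_of_countable (countable_range fun j => h (a j))
  refine hs.unbounded ⟨g, ?_⟩
  rintro _ ⟨b, rfl⟩
  obtain ⟨_, ⟨j, rfl⟩, hj⟩ := not_bddAbove_iff.1 hcon b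
  exact (hs.le _ _ hj.le).trans (hg _ ⟨j, rfl⟩)

theorem nonempty (hs : IsScale h) : Nonempty I := by
  by_contra hcon
  rw [not_nonempty_iff] at hcon
  exact hs.unbounded ⟨0, by rintro _ ⟨b, _⟩; exact hcon.elim b⟩

/-- Some member of the scale bounds, on a common infinite set, all functions attached to finite
sets of smaller indices. -/
theorem exists_bound_on_infinite [WellFoundedLT I] (hs : IsScale h) (φ : Finset I → ℕ → ℕ) :
    ∃ (a : I) (k : ℕ → ℕ), StrictMono k ∧
      ∀ b : Finset I, (∀ c ∈ b, c < a) → ∀ᶠ j in atTop, φ b (k j) < h a (k j) := by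
  classical
  choose B hB using fun a => hs.bounded a φ
  choose nxt hnxt hnxt' using hs.exists_not_le
  obtain ⟨a₀⟩ := hs.nonempty
  -- Each new index escapes the current function, which dominates `B` at every index reached so far.
  let p : ℕ → I × (ℕ → ℕ) := fun j => Nat.rec (a₀, B a₀)
    (fun _ q => (nxt q.1 q.2, fun n => q.2 n + B (nxt q.1 q.2) n)) j
  have hp : ∀ j, p (j + 1) =
      (nxt (p j).1 (p j).2, fun n => (p j).2 n + B (nxt (p j).1 (p j).2) n) := fun _ => rfl
  have hBp : ∀ j n, B (p j).1 n ≤ (p j).2 n := by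
    rintro (_ | j) n
    · exact le_rfl
    · rw [hp]
      exact Nat.le_add_left _ _
  have hmono : Monotone fun j => (p j).1 := monotone_nat_of_le_succ fun j => by
    rw [hp]
    exact hnxt _ _
  have hgmono : Monotone fun j => (p j).2 := monotone_nat_of_le_succ fun j => by
    intro n
    rw [hp]
    exact Nat.le_add_right _ _
  -- Leastness of `a` puts every finite set of smaller indices below some stage.
  obtain ⟨a, ha, hmin⟩ : ∃ a, a ∈ upperBounds (range fun j => (p j).1) ∧
      ∀ c, c < a → c ∉ upperBounds (range fun j => (p j).1) :=
    ⟨_, WellFounded.min_mem wellFounded_lt _ (hs.bddAbove_range fun j => (p j).1),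
      fun c hc hc' => WellFounded.not_lt_min wellFounded_lt _ hc' hc⟩
  have hfreq : ∀ j, ∃ᶠ n in atTop, (p j).2 n < h a n := by
    intro j hcon
    have h1 := hnxt' (p j).1 (p j).2
    refine h1 ?_
    have h2 := hs.le _ _ (ha ⟨j + 1, rfl⟩)
    filter_upwards [h2, hcon] with n hn hn'
    rw [hp] at hn
    exact hn.trans (not_lt.1 hn')
  obtain ⟨k, hk, hk'⟩ := extraction_forall_of_frequently hfreq
  refine ⟨a, k, hk, fun b hb => ?_⟩
  obtain ⟨j₀, hj₀⟩ : ∃ j, ∀ c ∈ b, c < (p j).1 := by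
    induction b using Finset.induction_on with
    | empty => exact ⟨0, by simp⟩
    | insert c b _ ih =>
      obtain ⟨j, hj⟩ := ih fun d hd => hb d (Finset.mem_insert_of_mem hd)
      have h1 := hmin c (hb c (Finset.mem_insert_self _ _))
      simp only [mem_upperBounds, forall_mem_range, not_forall, not_le] at h1
      obtain ⟨i, hi⟩ := h1
      refine ⟨max i j, fun d hd => ?_⟩
      rcases Finset.mem_insert.1 hd with rfl | hd
      · exact hi.trans_le (hmono (le_max_left _ _))
      · exact (hj d hd).trans_le (hmono (le_max_right _ _))
  filter_upwards [hk.tendsto_atTop.eventually (hB _ b hj₀), eventually_ge_atTop j₀] with j h1 h2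
  exact (h1.trans (hBp _ _)).trans_lt ((hgmono h2 _).trans_lt (hk' j))

/-- Recursively defined functions do not bound a scale. -/
theorem exists_frequently_lt (hs : IsScale h) (g : ℕ → ℕ → ℕ) :
    ∃ a, ∃ᶠ n in atTop, g n (h a n) < h a (n + 1) := by
  by_contra! hcon
  let G : ℕ → ℕ → ℕ := fun n v => ∑ w ∈ Finset.range (v + 1), g n w
  have hG : ∀ n v w, w ≤ v → g n w ≤ G n v := fun n v w hw =>
    Finset.single_le_sum (f := fun w => g n w) (fun _ _ => Nat.zero_le _)
      (Finset.mem_range.2 (by omega))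
  -- A counterexample `h a` is eventually below an iteration of the monotone majorant `G`; only
  -- countably many starting pairs exist.
  let it : ℕ → ℕ → ℕ → ℕ := fun m v d => Nat.rec v (fun d w => G (m + d) w) d
  obtain ⟨B, hB⟩ := eventuallyBounded_of_countable
    (countable_range fun q : ℕ × ℕ => fun n => it q.1 q.2 (n - q.1))
  refine hs.unbounded ⟨B, ?_⟩
  rintro _ ⟨a, rfl⟩
  obtain ⟨m, hm⟩ := eventually_atTop.1 (hcon a)
  have key : ∀ d, h a (m + d) ≤ it m (h a m) d := by
    intro d
    induction d with
    | zero => exact le_rfl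
    | succ d ih =>
      have h1 := hm (m + d) (by omega)
      exact h1.trans (hG _ _ _ ih)
  filter_upwards [hB _ ⟨(m, h a m), rfl⟩, eventually_ge_atTop m] with n h1 h2
  have h3 := key (n - m)
  rw [Nat.add_sub_cancel' h2] at h3
  exact h3.trans h1

end IsScale

/-! ### The space -/

/-- First column coordinate of a natural number. -/
def colFst (i : ℕ) : ℕ := (Nat.unpair (Nat.unpair i).1).1

/-- Second column coordinate of a natural number. -/
def colSnd (i : ℕ) : ℕ := (Nat.unpair (Nat.unpair i).1).2

theorem colSnd_le (i : ℕ) : colSnd i ≤ i :=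
  (Nat.unpair_right_le _).trans (Nat.unpair_left_le _)

theorem exists_col_eq (n l m : ℕ) : ∃ i, m ≤ i ∧ colFst i = n ∧ colSnd i = l :=
  ⟨Nat.pair (Nat.pair n l) m, Nat.right_le_pair _ _, by simp [colFst], by simp [colSnd]⟩

/-- The function `f` kills `i`. -/
def Kills (f : ℕ → ℕ) (i : ℕ) : Prop := colSnd i = f (colFst i) ∧ i < f (colFst i + 1)

/-- Every killed element of `t` is rescued by a later element of `t` which is not killed and not
too late. -/
def Alive (f : ℕ → ℕ) (t : Finset ℕ) : Prop :=
  ∀ j ∈ t, Kills f j → ∃ i ∈ t, j < i ∧ ¬ Kills f i ∧ i < f j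

theorem alive_empty (f : ℕ → ℕ) : Alive f ∅ := by simp [Alive]

theorem not_alive_of_kills_max {f : ℕ → ℕ} {t : Finset ℕ} {m : ℕ} (hm : m ∈ t)
    (hmax : ∀ i ∈ t, i ≤ m) (hk : Kills f m) : ¬ Alive f t := fun ha => by
  obtain ⟨i, hi, hlt, -⟩ := ha m hm hk
  exact hlt.not_ge (hmax i hi)

/-- If `u` end-extends `t` beyond all the deadlines of `t`, the last element of `u` is not killed,
and it meets the deadlines of all the new elements, then `u` and `t` have the same status. -/
theorem alive_iff_of_endExtension {f : ℕ → ℕ} {t u : Finset ℕ} {k m : ℕ}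
    (htk : ∀ i ∈ t, i < k) (htf : ∀ i ∈ t, f i ≤ k) (hut : ∀ i < k, i ∈ u ↔ i ∈ t)
    (hm : m ∈ u) (hmk : ¬ Kills f m) (hmax : ∀ i ∈ u, i ≤ m)
    (hdl : ∀ i ∈ u, k ≤ i → i < m → m < f i) : Alive f u ↔ Alive f t := by
  constructor
  · intro hu j hj hjk
    obtain ⟨i, hi, h1, h2, h3⟩ := hu j ((hut j (htk j hj)).2 hj) hjk
    exact ⟨i, (hut i (h3.trans_le (htf j hj))).1 hi, h1, h2, h3⟩
  · intro ht j hj hjk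
    by_cases hjlt : j < k
    · obtain ⟨i, hi, h1⟩ := ht j ((hut j hjlt).1 hj) hjk
      exact ⟨i, (hut i (htk i hi)).2 hi, h1⟩
    · have hne : j ≠ m := fun hjm => hmk (hjm ▸ hjk)
      have hlt : j < m := lt_of_le_of_ne (hmax j hj) hne
      exact ⟨m, hm, hlt, hmk, hdl j hj (not_lt.1 hjlt) hlt⟩

/-- Finite sets of naturals, with the topology in which membership and the status with respect to
each `h a` are clopen conditions. -/
def ScaleSpace {I : Type} (_ : I → ℕ → ℕ) : Type := Finset ℕ

/-! ### Topology and basic neighbourhoods. -/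

namespace ScaleSpace

variable {I : Type} {h : I → ℕ → ℕ}

open Classical in
/-- The coordinates defining the topology. -/
noncomputable def coord (h : I → ℕ → ℕ) (t : ScaleSpace h) : ℕ ⊕ I → Bool :=
  Sum.elim (fun i => decide (i ∈ (show Finset ℕ from t))) fun a => decide (Alive (h a) t)

noncomputable instance : TopologicalSpace (ScaleSpace h) :=
  TopologicalSpace.induced (coord h) inferInstance

instance : Countable (ScaleSpace h) := inferInstanceAs (Countable (Finset ℕ))

theorem isInducing_coord : IsInducing (coord h) := ⟨rfl⟩

theorem coord_injective : Function.Injective (coord h) := by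
  intro t u htu
  refine Finset.ext fun i => ?_
  have := congrFun htu (Sum.inl i)
  simpa [coord] using this

instance : T2Space (ScaleSpace h) :=
  T2Space.of_injective_continuous coord_injective isInducing_coord.continuous

theorem zeroDimensional : ZeroDimensional (ScaleSpace h) := by
  refine isTopologicalBasis_of_isOpen_of_nhds (fun u hu => hu.isOpen) fun t U ht hU => ?_
  obtain ⟨V, hV, rfl⟩ := isInducing_coord.isOpen_iff.1 hU
  obtain ⟨W, hW, htW, hWV⟩ :=
    (isTopologicalBasis_isClopen (X := ℕ ⊕ I → Bool)).exists_subset_of_mem_open ht hV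
  exact ⟨coord h ⁻¹' W, IsClopen.preimage hW isInducing_coord.continuous, htW,
    preimage_mono hWV⟩

theorem continuous_coord_apply (x : ℕ ⊕ I) : Continuous fun t : ScaleSpace h => coord h t x :=
  (continuous_apply x).comp isInducing_coord.continuous

theorem isOpen_alive (a : I) : IsOpen {t : ScaleSpace h | Alive (h a) t} := by
  have := (isOpen_discrete {true}).preimage (continuous_coord_apply (h := h) (Sum.inr a))
  convert this using 1
  ext t
  simp only [coord, Sum.elim_inr, mem_preimage, mem_singleton_iff, decide_eq_true_eq]
  exact Iff.rfl

/-- The basic neighbourhood of `t` given by agreement below `r` and equal status on `b`. -/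
def nbhd (t : ScaleSpace h) (r : ℕ) (b : Finset I) : Set (ScaleSpace h) :=
  {u | (∀ i < r, i ∈ (show Finset ℕ from u) ↔ i ∈ (show Finset ℕ from t)) ∧
    ∀ a ∈ b, Alive (h a) u ↔ Alive (h a) t}

theorem mem_nbhd_self (t : ScaleSpace h) (r : ℕ) (b : Finset I) : t ∈ nbhd t r b :=
  ⟨fun _ _ => Iff.rfl, fun _ _ => Iff.rfl⟩

theorem isOpen_nbhd (t : ScaleSpace h) (r : ℕ) (b : Finset I) : IsOpen (nbhd t r b) := by
  have heq : nbhd t r b =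
      (⋂ i ∈ Finset.range r, {u | coord h u (Sum.inl i) = coord h t (Sum.inl i)}) ∩
        ⋂ a ∈ b, {u | coord h u (Sum.inr a) = coord h t (Sum.inr a)} := by
    ext u
    simp [nbhd, coord]
  rw [heq]
  refine IsOpen.inter (isOpen_biInter_finset fun i _ => ?_) (isOpen_biInter_finset fun a _ => ?_)
  · exact (isOpen_discrete {_}).preimage (continuous_coord_apply (h := h) (Sum.inl i))
  · exact (isOpen_discrete {_}).preimage (continuous_coord_apply (h := h) (Sum.inr a))

theorem exists_nbhd_subset {U : Set (ScaleSpace h)} (hU : IsOpen U) {t : ScaleSpace h}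
    (ht : t ∈ U) : ∃ r b, nbhd t r b ⊆ U := by
  classical
  obtain ⟨V, hV, rfl⟩ := isInducing_coord.isOpen_iff.1 hU
  obtain ⟨J, u, hu, hJ⟩ := isOpen_pi_iff.1 hV _ ht
  refine ⟨J.toLeft.sup id + 1, J.toRight, fun v hv => hJ fun x hx => ?_⟩
  have hx' : coord h v x = coord h t x := by
    rcases x with i | a
    · have : i ≤ J.toLeft.sup id :=
        Finset.le_sup (f := id) (Finset.mem_toLeft.2 hx)
      simpa [coord] using hv.1 i (by omega)
    · simpa [coord] using hv.2 a (Finset.mem_toRight.2 hx)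
  rw [hx']
  exact (hu x hx).2

/-- The largest element of a point (and `0` for the empty set). -/
def top (t : ScaleSpace h) : ℕ := Finset.sup (show Finset ℕ from t) id

theorem le_top {t : ScaleSpace h} {i : ℕ} (hi : i ∈ (show Finset ℕ from t)) : i ≤ top t :=
  Finset.le_sup (f := id) hi

theorem top_mem {t : ScaleSpace h} {i : ℕ} (hi : i ∈ (show Finset ℕ from t)) :
    top t ∈ (show Finset ℕ from t) := by
  obtain ⟨m, hm, hm'⟩ := Finset.exists_mem_eq_sup (show Finset ℕ from t) ⟨i, hi⟩ id
  have : top t = m := hm'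
  rwa [this]

/-- The points whose largest element lies in a given column. -/
def column (h : I → ℕ → ℕ) (n l : ℕ) : Set (ScaleSpace h) :=
  {t | top t ∈ (show Finset ℕ from t) ∧ colFst (top t) = n ∧ colSnd (top t) = l}

/-- Every basic neighbourhood contains proper end-extensions ending in a prescribed column. -/
theorem exists_mem_nbhd_column (t : ScaleSpace h) (r : ℕ) (b : Finset I) (n l : ℕ) :
    ∃ u ∈ nbhd t r b, u ≠ t ∧ u ∈ column h n l := by
  classical
  let T : Finset ℕ := t
  -- The new maximum lies beyond `r`, all of `T` and its deadlines, and beyond `h a (n + 1)`, so it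
  -- is not killed.
  obtain ⟨i, hi, rfl, rfl⟩ := exists_col_eq n l
    (r + (T.sup id + 1) + ∑ a ∈ b, (h a (n + 1) + ∑ j ∈ T, h a j))
  have hT : ∀ j ∈ T, j < i := fun j hj => by
    have : j ≤ T.sup id := Finset.le_sup (f := id) hj
    omega
  have hmax : ∀ j ∈ insert i T, j ≤ i := fun j hj => by
    rcases Finset.mem_insert.1 hj with rfl | hj
    · exact le_rfl
    · exact (hT j hj).le
  have htop : top (h := h) (insert i T : Finset ℕ) = i :=
    le_antisymm (Finset.sup_le hmax) (le_top (h := h) (Finset.mem_insert_self i T))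
  have hagree : ∀ j < i, j ∈ insert i T ↔ j ∈ T := fun j hj => by
    simp [hj.ne]
  refine ⟨(insert i T : Finset ℕ), ⟨fun j hj => hagree j (by omega), fun a ha => ?_⟩, ?_, ?_⟩
  · have hsum : h a (colFst i + 1) + ∑ j ∈ T, h a j ≤ i :=
      le_trans (le_trans (Finset.single_le_sum
        (f := fun a => h a (colFst i + 1) + ∑ j ∈ T, h a j) (fun _ _ => Nat.zero_le _) ha)
        (Nat.le_add_left _ _)) hi
    refine alive_iff_of_endExtension hT (fun j hj => ?_) hagree (Finset.mem_insert_self i T)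
      ?_ hmax fun j _ h1 h2 => absurd h2 h1.not_gt
    · have : h a j ≤ ∑ j ∈ T, h a j :=
        Finset.single_le_sum (f := fun j => h a j) (fun _ _ => Nat.zero_le _) hj
      omega
    · rintro ⟨-, hlt⟩
      omega
  · intro heq
    have h1 : i ∈ T := by
      have h2 : insert i T = T := heq
      rw [← h2]
      exact Finset.mem_insert_self i T
    exact lt_irrefl _ (hT i h1)
  · refine ⟨?_, ?_, ?_⟩
    · rw [htop]
      exact Finset.mem_insert_self i T
    · rw [htop]
    · rw [htop]

theorem dense_column (n l : ℕ) : Dense (column h n l) := by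
  refine dense_iff_inter_open.2 fun U hU ⟨t, ht⟩ => ?_
  obtain ⟨r, b, hrb⟩ := exists_nbhd_subset hU ht
  obtain ⟨u, hu, -, huc⟩ := exists_mem_nbhd_column t r b n l
  exact ⟨u, hrb hu, huc⟩

theorem exists_mem_ne {U : Set (ScaleSpace h)} (hU : IsOpen U) {t : ScaleSpace h} (ht : t ∈ U) :
    ∃ u ∈ U, u ≠ t := by
  obtain ⟨r, b, hrb⟩ := exists_nbhd_subset hU ht
  obtain ⟨u, hu, hne, -⟩ := exists_mem_nbhd_column t r b 0 0
  exact ⟨u, hrb hu, hne⟩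

/-! ### Failure of H-separability. -/

theorem not_hSeparable [LinearOrder I] (hs : IsScale h) : ¬ HSeparable (ScaleSpace h) := by
  intro hH
  obtain ⟨F, hF, hd⟩ := hH (fun q => column h q.unpair.1 q.unpair.2) fun q => dense_column _ _
  obtain ⟨a, ha⟩ := hs.exists_frequently_lt fun n l => (F (Nat.pair n l)).sup top
  let A : Set ℕ := {q | ∃ n, (F q).sup top < h a (n + 1) ∧ q = Nat.pair n (h a n)}
  have hA : A.Infinite := by
    have hinf := Nat.frequently_atTop_iff_infinite.1 ha
    refine (hinf.image (f := fun n => Nat.pair n (h a n)) fun m _ n _ hmn => ?_).mono ?_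
    · exact (Nat.pair_eq_pair.1 hmn).1
    · rintro _ ⟨n, hn, rfl⟩
      exact ⟨n, hn, rfl⟩
  obtain ⟨t, hta, htF⟩ := (hd A hA).inter_open_nonempty _ (isOpen_alive a)
    ⟨(∅ : Finset ℕ), alive_empty _⟩
  simp only [mem_iUnion] at htF
  obtain ⟨q, ⟨n, hlt, rfl⟩, ht⟩ := htF
  have hcol := hF _ ht
  simp only [Nat.unpair_pair] at hcol
  obtain ⟨hmem, h1, h2⟩ := hcol
  refine not_alive_of_kills_max hmem (fun i hi => le_top hi) ⟨?_, ?_⟩ hta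
  · rw [h1, h2]
  · rw [h1]
    exact (Finset.le_sup (f := top) ht).trans_lt hlt

/-! ### Selections from descending sequences. -/

/-- Points at which a convergent selection from a descending sequence `D` can be found. -/
def IsSelectable (D : ℕ → Set (ScaleSpace h)) (t : ScaleSpace h) : Prop :=
  ∃ G : ℕ → Finset (ScaleSpace h), (∀ k, (G k : Set (ScaleSpace h)) ⊆ D k) ∧
    ∀ r b, ∀ᶠ k in atTop, (nbhd t r b ∩ G k).Nonempty

/-- The part of `D k` whose columns are either below `R` or at least `k`. -/
def sift (D : ℕ → Set (ScaleSpace h)) (R k : ℕ) (t : ScaleSpace h) : Set (ScaleSpace h) :=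
  {u ∈ D k | u ≠ t ∧ (colFst (top u) < R ∨ k ≤ colFst (top u))}

/-- If `t₀` fails for `R = 0` at stage `k₀`, nearby points of `D k₀` have columns below `k₀`; a
nearby `t₁` then cannot fail for `R = k₀`, because `D` descends. -/
theorem exists_sift {D : ℕ → Set (ScaleSpace h)} (hD : Antitone D) (hd : ∀ n, Dense (D n))
    {U : Set (ScaleSpace h)} (hU : IsOpen U) (hne : U.Nonempty) :
    ∃ t ∈ U, ∃ R, ∀ k r b, (nbhd t r b ∩ sift D R k t).Nonempty := by
  by_contra! hcon
  obtain ⟨t₀, ht₀⟩ := hne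
  obtain ⟨k₀, r, b, hempty⟩ := hcon t₀ ht₀ 0
  obtain ⟨t₁, ⟨ht₁, ht₁U⟩, hne⟩ := exists_mem_ne ((isOpen_nbhd t₀ r b).inter hU)
    ⟨mem_nbhd_self _ _ _, ht₀⟩
  obtain ⟨k, r', b', hempty'⟩ := hcon t₁ ht₁U k₀
  have hopen : IsOpen ((nbhd t₀ r b ∩ {t₀}ᶜ) ∩ nbhd t₁ r' b') :=
    ((isOpen_nbhd t₀ r b).inter isOpen_compl_singleton).inter (isOpen_nbhd t₁ r' b')
  obtain ⟨t₂, ht₂, hne₂⟩ := exists_mem_ne hopen ⟨⟨ht₁, hne⟩, mem_nbhd_self _ _ _⟩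
  obtain ⟨u, ⟨⟨⟨hu0, hune⟩, hu1⟩, hune'⟩, huD⟩ := (hd (max k k₀)).inter_open_nonempty _
    (hopen.inter (isOpen_compl_singleton (x := t₁))) ⟨t₂, ht₂, hne₂⟩
  by_cases hlt : colFst (top u) < k₀
  · exact notMem_empty u (hempty' ▸
      ⟨hu1, hD (le_max_left _ _) huD, hune', Or.inl hlt⟩)
  · exact notMem_empty u (hempty ▸
      ⟨hu0, hD (le_max_right _ _) huD, hune, Or.inr (not_lt.1 hlt)⟩)

theorem isSelectable_of_sift [LinearOrder I] [WellFoundedLT I] (hs : IsScale h) {D : ℕ → Set (ScaleSpace h)}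
    (hD : Antitone D) {t : ScaleSpace h} {R : ℕ}
    (ht : ∀ k r b, (nbhd t r b ∩ sift D R k t).Nonempty) : IsSelectable D t := by
  classical
  choose w hw hwD using fun (b : Finset I) k => ht k k b
  obtain ⟨a, k, hk, ha⟩ := hs.exists_bound_on_infinite fun b k => top (w b k)
  -- The bound on `top` makes `T j` finite, with no reference to the finite set of indices to be
  -- respected.
  let T : ℕ → Set (ScaleSpace h) := fun j =>
    {u ∈ sift D R (k j) t | u ∈ nbhd t (k j) ∅ ∧ top u < h a (k j)}
  have hfin : ∀ j, (T j).Finite := fun j => by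
    refine (Finset.finite_toSet (Finset.powerset (Finset.range (h a (k j))))).subset ?_
    rintro u ⟨-, -, hu⟩
    exact Finset.mem_coe.2 (Finset.mem_powerset.2 fun i hi =>
      Finset.mem_range.2 ((le_top hi).trans_lt hu))
  refine ⟨fun j => (hfin j).toFinset, fun j u hu => ?_, fun r b => ?_⟩
  · have hu' : u ∈ T j := by simpa using hu
    exact hD (hk.id_le j) hu'.1.1
  have hlow := ha (b.filter (· < a)) fun c hc => (Finset.mem_filter.1 hc).2
  have hhigh : ∀ᶠ j in atTop, ∀ c ∈ b, a ≤ c → h a (k j) ≤ h c (k j) := by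
    refine (Filter.eventually_all_finset b).2 fun c _ => ?_
    by_cases hc : a ≤ c
    · filter_upwards [hk.tendsto_atTop.eventually (hs.le a c hc)] with j hj _ using hj
    · exact Eventually.of_forall fun j hac => absurd hac hc
  have hlarge := hk.tendsto_atTop.eventually_ge_atTop
    (r + (top t + 1) + ∑ c ∈ b, (h c R + h c (top t)))
  filter_upwards [hlow, hhigh, hlarge] with j h1 h2 h3
  have hun := hw (b.filter (· < a)) (k j)
  have hus := hwD (b.filter (· < a)) (k j)
  generalize w (b.filter (· < a)) (k j) = u at h1 hun hus
  have htk : ∀ i ∈ (show Finset ℕ from t), i < k j := fun i hi => by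
    have := le_top hi
    omega
  obtain ⟨m, hm, hkm⟩ : ∃ m ∈ (show Finset ℕ from u), k j ≤ m := by
    by_contra! hcon
    exact hus.2.1 (Finset.ext fun i => ⟨fun hi => (hun.1 i (hcon i hi)).1 hi,
      fun hi => (hun.1 i (htk i hi)).2 hi⟩)
  have hktop : k j ≤ top u := hkm.trans (le_top hm)
  refine ⟨u, ⟨fun i hi => hun.1 i (by omega), fun c hc => ?_⟩, ?_⟩
  · by_cases hca : c < a
    · exact hun.2 c (Finset.mem_filter.2 ⟨hc, hca⟩)
    have hac := h2 c hc (not_lt.1 hca)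
    have hsum : h c R + h c (top t) ≤ ∑ c ∈ b, (h c R + h c (top t)) :=
      Finset.single_le_sum (f := fun c => h c R + h c (top t)) (fun _ _ => Nat.zero_le _) hc
    refine alive_iff_of_endExtension htk (fun i hi => ?_) hun.1 (top_mem hm) ?_
      (fun i hi => le_top hi) fun i _ hki _ => ?_
    · have := hs.mono c (le_top hi)
      omega
    · rintro ⟨hk1, hk2⟩
      -- A column below `R` has its killing range below `k j`; one from `k j` on has `h c` there
      -- exceeding `top u`, hence its `colSnd`.
      rcases hus.2.2 with hlt | hge
      · have := hs.mono c (Nat.succ_le_of_lt hlt)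
        simp only [Nat.succ_eq_add_one] at this
        omega
      · have h4 := hs.mono c hge
        have h5 := colSnd_le (top u)
        omega
    · have := hs.mono c hki
      omega
  · have : u ∈ T j := ⟨hus, ⟨hun.1, by simp⟩, h1⟩
    simpa using this

theorem mhSeparable [LinearOrder I] [WellFoundedLT I] (hs : IsScale h) : MHSeparable (ScaleSpace h) := by
  classical
  intro D hD hd
  have hex : ∀ t : ScaleSpace h, ∃ G : ℕ → Finset (ScaleSpace h),
      (∀ k, (G k : Set (ScaleSpace h)) ⊆ D k) ∧
        (IsSelectable D t → ∀ r b, ∀ᶠ k in atTop, (nbhd t r b ∩ G k).Nonempty) := by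
    intro t
    by_cases ht : IsSelectable D t
    · obtain ⟨G, h1, h2⟩ := ht
      exact ⟨G, h1, fun _ => h2⟩
    · exact ⟨fun _ => ∅, by simp, fun h' => absurd h' ht⟩
  choose G hGD hG using hex
  have : Nonempty (ScaleSpace h) := ⟨(∅ : Finset ℕ)⟩
  obtain ⟨e, he⟩ := exists_surjective_nat (ScaleSpace h)
  -- The selection for the point `e c` takes part from stage `c` on.
  refine ⟨fun n => (Finset.range (n + 1)).biUnion fun c => G (e c) n, fun n u hu => ?_,
    fun A hA => dense_iff_inter_open.2 fun U hU hne => ?_⟩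
  · simp only [Finset.coe_biUnion, mem_iUnion] at hu
    obtain ⟨c, -, hu⟩ := hu
    exact hGD _ _ hu
  · obtain ⟨t, htU, R, ht⟩ := exists_sift hD hd hU hne
    obtain ⟨r, b, hrb⟩ := exists_nbhd_subset hU htU
    obtain ⟨c, rfl⟩ := he t
    have hev := hG _ (isSelectable_of_sift hs hD ht) r b
    obtain ⟨n, ⟨⟨u, hu, huG⟩, hcn⟩, hnA⟩ := ((hev.and (eventually_ge_atTop c)).and_frequently
      (Nat.frequently_atTop_iff_infinite.2 hA)).exists
    refine ⟨u, hrb hu, ?_⟩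
    simp only [mem_iUnion, Finset.coe_biUnion]
    exact ⟨n, hnA, c, by simpa using Nat.lt_succ_of_le hcn, huG⟩

end ScaleSpace

theorem theorem1p1 :
    ∃ (X : Type) (_ : TopologicalSpace X),
      Countable X ∧ T2Space X ∧ ZeroDimensional X ∧ MHSeparable X ∧ ¬ HSeparable X := by
  obtain ⟨I, _, _, h, hs⟩ := exists_isScale
  exact ⟨ScaleSpace h, inferInstance, inferInstance, inferInstance, ScaleSpace.zeroDimensional,
    ScaleSpace.mhSeparable hs, ScaleSpace.not_hSeparable hs⟩
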